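/- Let $n,p$ be natural numbers, let $\mathbb S^n$ be the space of real symmetric $n\times n$ matrices with the Frobenius inner product, and let $\mathcal S_n=\{X\in\mathbb S^n : X\succeq 0,\ \mathrm{Tr}(X)=1\}$. Consider $$\min_{X\in\mathcal S_n,\ y\in\mathcal K} f(X,y):=g(\mathcal A X+y)+\langle C,X\rangle+\langle c,y\rangle ,$$ where $g:\mathbb R^p\to\mathbb R$ is $\alpha_g$-strongly convex and $\beta_g$-smooth (differentiable with $\beta_g$-Lipschitz gradient), $\alpha_g,\beta_g>0$, $\mathcal A:\mathbb S^n\to\mathbb R^p$ is linear with operator norm $\|\mathcal A\|$, $\mathcal K\subset\mathbb R^p$ is convex and compact with Euclidean diameter $D_{\mathcal K}$, $C\in\mathbb S^n$ and $c\in\mathbb R^p$. Let $f^*$ be the optimal value. Consider the following algorithm. It starts from an arbitrary point $(X_1,y_1)\in\mathcal S_n\times\mathcal K$ and, for $t=1,2,\dots$, * sets $y_{t+1}=\Pi_{\mathcal K}\big[y_t-\tfrac{1}{2\beta_g}\nabla_y f(X_t,y_t)\big]$ (Euclidean projection onto $\mathcal K$); * takes $v_t$ to be a unit eigenvector of $-\nabla_X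 f(X_t,y_t)$ for its largest eigenvalue; * takes $\eta_t\in\arg\min_{\eta\in[0,1]} f\big((1-\eta)X_t+\eta v_tv_t^\top,\,y_{t+1}\big)$; * sets $X_{t+1}=(1-\eta_t)X_t+\eta_t v_tv_t^\top$. Let $(X_t,y_t)_{t\ge1}$ be any sequence it produces, and put $h_t=f(X_t,y_t)-f^*$. Below, $O(\cdot)$ hides only universal numerical constants, independent of $n$, $p$, the problem data and the run. 1. For all $t\ge 2$, $$h_t=O\!\left(\frac{\beta_g(\|\mathcal A\|^2+D_{\mathcal K}^2)}{t}\right).$$ Suppose moreover that $n\ge2$ and that the following gap assumption holds: for some $\delta>0$, $\lambda_{n-1}(\nabla_X f(X,y))-\lambda_n(\nabla_X f(X,y))=\delta$ at every optimal solution $(X,y)$, where $\lambda_1\ge\dots\ge\lambda_n$ denote the eigenvalues with multiplicity. Then the problem has a unique optimal solution $(X^*,y^*)$, and the following hold. 2. There is an integer $T_0\ge 0$ with $$T_0=O\!\left(\frac{\|\mathcal A\|^2\beta_g^3(\|\mathcal A\|^2+D_{\mathcal K}^2)}{\alpha_g\delta^2}\right)$$ such that for all $t\ge1$ with $t\ge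 T_0$, $$h_{t+1}\le h_t\left(1-\min\left\{\frac16,\ \frac{\alpha_g\delta^2}{4\beta_g\left(6\alpha_g\delta\|\mathcal A\|^2+4\delta^2+32\|\mathcal A\|^2\beta_g^2\right)},\ \frac{\delta}{72\beta_g\|\mathcal A\|^2}\right\}\right),$$ where the last term of the minimum is read as $+\infty$ if $\mathcal A=0$. 3. For all $t\ge1$, $$\|v_tv_t^\top-X^*\|_F^2=O\!\left(\frac{\beta_g^2\|\mathcal A\|^2}{\alpha_g\delta^2}\,h_t\right).$$ -/

import Mathlib

noncomputable section

namespace FWMix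

/-- The Euclidean space `ℝᵖ`. -/
abbrev Vec (p : ℕ) : Type := EuclideanSpace ℝ (Fin p)

/-- Real symmetric `n × n` matrices, as a subspace of the Euclidean space of all arrays indexed by
pairs `(i, j)`; the inherited inner product and norm are the Frobenius ones. -/
def symSubmodule (n : ℕ) : Submodule ℝ (EuclideanSpace ℝ (Fin n × Fin n)) where
  carrier := {X | ∀ i j, X (i, j) = X (j, i)}
  add_mem' := by
    intro X Y hX hY i j
    simp [hX i j, hY i j]
  zero_mem' := by
    intro i j
    simp
  smul_mem' := by
    intro c X hX i j
    simp [hX i j]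

/-- The space `𝕊ⁿ` of real symmetric `n × n` matrices with the Frobenius inner product. -/
abbrev Sym (n : ℕ) : Type := ↥(symSubmodule n)

instance (n : ℕ) : CompleteSpace (Sym n) := FiniteDimensional.complete ℝ (Sym n)

/-- The underlying matrix. -/
def Sym.toMat {n : ℕ} (X : Sym n) : Matrix (Fin n) (Fin n) ℝ :=
  Matrix.of fun i j => (X : EuclideanSpace ℝ (Fin n × Fin n)) (i, j)

theorem Sym.isHermitian {n : ℕ} (X : Sym n) : X.toMat.IsHermitian := by
  ext i j
  exact X.2 j i

theorem Sym.inner_eq_trace {n : ℕ} (X Y : Sym n) :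
    inner ℝ X Y = (X.toMat * Y.toMat).trace := by
  rw [Submodule.coe_inner, PiLp.inner_apply, Fintype.sum_prod_type]
  refine Finset.sum_congr rfl fun i _ => ?_
  simp only [Matrix.diag_apply, Matrix.mul_apply]
  refine Finset.sum_congr rfl fun j _ => ?_
  have h : Y.toMat j i = (Y : EuclideanSpace ℝ (Fin n × Fin n)) (i, j) := Y.2 j i
  rw [h]
  simp [Sym.toMat, mul_comm]

/-- The rank-one matrix `v vᵀ`. -/
def outer {n : ℕ} (v : Vec n) : Sym n :=
  ⟨WithLp.toLp 2 fun ij => v ij.1 * v ij.2, fun i j => mul_comm (v i) (v j)⟩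

/-- The spectrahedron: positive semidefinite matrices of unit trace. -/
def spectrahedron (n : ℕ) : Set (Sym n) :=
  {X | X.toMat.PosSemidef ∧ X.toMat.trace = 1}

/-- The eigenvalues of `M` with multiplicity, in non-increasing order; `eigval M k` is the
`(k+1)`-st largest one. -/
def eigval {n : ℕ} (M : Sym n) (k : Fin n) : ℝ :=
  M.isHermitian.eigenvalues₀ (Fin.cast (Fintype.card_fin n).symm k)

/-- The gap `λ_{n-1}(M) - λ_n(M)` between the two smallest eigenvalues (with multiplicity). -/
def eigGap {n : ℕ} (hn : 2 ≤ n) (M : Sym n) : ℝ :=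
  eigval M ⟨n - 2, by omega⟩ - eigval M ⟨n - 1, by omega⟩

/-- `v` is a unit eigenvector of `M` for its largest eigenvalue. -/
def IsLeadingEigenvector {n : ℕ} (M : Sym n) (v : Vec n) : Prop :=
  ‖v‖ = 1 ∧ ∃ μ : ℝ, Matrix.toEuclideanLin M.toMat v = μ • v ∧
    ∀ ν : ℝ, Module.End.HasEigenvalue (Matrix.toEuclideanLin M.toMat) ν → ν ≤ μ

/-- `z` is the Euclidean projection of `x` onto `K`. -/
def IsProj {p : ℕ} (K : Set (Vec p)) (x z : Vec p) : Prop :=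
  z ∈ K ∧ ∀ w ∈ K, ‖x - z‖ ≤ ‖x - w‖

/-- `g` is `β`-smooth: differentiable with `β`-Lipschitz gradient. -/
def IsSmooth {p : ℕ} (β : ℝ) (g : Vec p → ℝ) : Prop :=
  Differentiable ℝ g ∧ ∀ x y, ‖gradient g x - gradient g y‖ ≤ β * ‖x - y‖

/-- The data of the problem
`min { g (𝒜 X + y) + ⟨C, X⟩ + ⟨c, y⟩ : X in the spectrahedron, y ∈ K }`.
(All spaces are finite-dimensional, so every linear map `𝒜` is continuous.) -/
structure Problem (n p : ℕ) where
  g : Vec p → ℝ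
  A : Sym n →L[ℝ] Vec p
  C : Sym n
  c : Vec p
  K : Set (Vec p)

namespace Problem

variable {n p : ℕ} (P : Problem n p)

/-- The objective function. -/
def f (X : Sym n) (y : Vec p) : ℝ :=
  P.g (P.A X + y) + inner ℝ P.C X + inner ℝ P.c y

/-- The partial gradient of the objective in the matrix variable (Frobenius inner product). -/
def gradX (X : Sym n) (y : Vec p) : Sym n := gradient (fun Z => P.f Z y) X

/-- The partial gradient of the objective in the vector variable. -/
def gradY (X : Sym n) (y : Vec p) : Vec p := gradient (fun z => P.f X z) y

/-- The optimal value. -/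
def fstar : ℝ := sInf ((fun w : Sym n × Vec p => P.f w.1 w.2) '' (spectrahedron n ×ˢ P.K))

/-- `(X, y)` is an optimal solution. -/
def IsOptimal (X : Sym n) (y : Vec p) : Prop :=
  X ∈ spectrahedron n ∧ y ∈ P.K ∧
    ∀ X' ∈ spectrahedron n, ∀ y' ∈ P.K, P.f X y ≤ P.f X' y'

/-- The gap assumption with gap `δ > 0`: at every optimal solution the two smallest eigenvalues of
the gradient in the matrix variable differ by `δ`. -/
def GapAssumption (hn : 2 ≤ n) (δ : ℝ) : Prop :=
  0 < δ ∧ ∀ X y, P.IsOptimal X y → eigGap hn (P.gradX X y) = δ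

/-- `(X t, y t)`, `t ≥ 1`, with directions `v t` and step sizes `η t`, is a run of the projected
gradient / Frank-Wolfe method with smoothness parameter `β`. The values at `t = 0` are not used. -/
structure IsRun (β : ℝ) (X : ℕ → Sym n) (y : ℕ → Vec p) (v : ℕ → Vec n) (η : ℕ → ℝ) : Prop where
  X_init : X 1 ∈ spectrahedron n
  y_init : y 1 ∈ P.K
  y_step : ∀ t, 1 ≤ t → IsProj P.K (y t - (1 / (2 * β)) • P.gradY (X t) (y t)) (y (t + 1))
  v_step : ∀ t, 1 ≤ t → IsLeadingEigenvector (-P.gradX (X t) (y t)) (v t)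
  η_mem : ∀ t, 1 ≤ t → η t ∈ Set.Icc (0 : ℝ) 1
  η_min : ∀ t, 1 ≤ t → ∀ s ∈ Set.Icc (0 : ℝ) 1,
    P.f ((1 - η t) • X t + η t • outer (v t)) (y (t + 1)) ≤
      P.f ((1 - s) • X t + s • outer (v t)) (y (t + 1))
  X_step : ∀ t, 1 ≤ t → X (t + 1) = (1 - η t) • X t + η t • outer (v t)

end Problem

/-- The amount by which the linear contraction factor is below `1`, as a function of the strong
convexity `α`, the smoothness `β`, the gap `δ` and the operator norm `a`. When `a = 0` the last
term `δ / (72 β a²)` stands for `+∞` and is therefore absent from the minimum. -/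
def rate (α β δ a : ℝ) : ℝ :=
  if a = 0 then
    min (1 / 6)
      (α * δ ^ 2 / (4 * β * (6 * α * δ * a ^ 2 + 4 * δ ^ 2 + 32 * a ^ 2 * β ^ 2)))
  else
    min (1 / 6) (min
      (α * δ ^ 2 / (4 * β * (6 * α * δ * a ^ 2 + 4 * δ ^ 2 + 32 * a ^ 2 * β ^ 2)))
      (δ / (72 * β * a ^ 2)))

end FWMix

end

open Metric Set Filter Topology

namespace FWMix

/-! ### Quadratic bounds from strong convexity and smoothness. -/

section Calculus

variable {E : Type*} [NormedAddCommGroup E] [InnerProductSpace ℝ E] [CompleteSpace E]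

/-! Smoothness of `g` gives an upper model of `f` that separates in `X` and `y` (`Regular.f_upper`).
The projection step minimizes its `y`-part over `K`, and the line search is at least as good as any
fixed step `s`. By convexity, with `H` the current optimality gap, the next gap is at most `(1 - s)
* H + s * ⟨∇_X f, v vᵀ - X*⟩ + β s² * (‖𝒜(v vᵀ - X)‖² + ‖y* - y‖²)` (`IsRun.step_le_of_isOptimal`).
The inner product is nonpositive; dropping it and bounding the last bracket by diameters gives the
`1/t` rate.

Under the gap assumption the gradient at an optimum has a simple smallest eigenvalue, which forces
`X* = x xᵀ` and makes the linear functional it defines grow like `δ/2 * ‖X - X*‖²` on the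
spectrahedron (`IsOptimal.sharp`). With strong convexity of `g` this yields quadratic growth
(`IsOptimal.growth`), hence uniqueness and control of `‖X - X*‖²`, `‖y - y*‖²` and the gradient
error by `H`. Comparing the sharp growth at `v vᵀ` with optimality of `v` for the current gradient
bounds `‖v vᵀ - X*‖`.

Near the optimum `v vᵀ` is still better than `X*` for the current gradient, by `δ/4 * ‖v vᵀ - X*‖²`
(`inner_outer_sub_le_of_near`). This negative term absorbs the part of the quadratic error due to `v
vᵀ`; what remains is `O(s² H)`, so a constant `s` contracts linearly. The `1/t` rate determines when
the iterates are near enough. -/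

theorem hasDerivAt_comp_line {g : E → ℝ} (hd : Differentiable ℝ g) (x d : E) (t : ℝ) :
    HasDerivAt (fun s : ℝ => g (x + s • d)) (inner ℝ (gradient g (x + t • d)) d) t := by
  have h1 : HasDerivAt (fun s : ℝ => x + s • d) d t := by
    simpa using ((hasDerivAt_id t).smul_const d).const_add x
  have h2 := ((hd (x + t • d)).hasGradientAt.hasFDerivAt).comp_hasDerivAt t h1
  simpa [Function.comp_def] using! h2

theorem first_order_of_strongConvexOn {g : E → ℝ} {α : ℝ} (hd : Differentiable ℝ g)
    (hg : StrongConvexOn Set.univ α g) (x z : E) :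
    g x + inner ℝ (gradient g x) (z - x) + α / 2 * ‖z - x‖ ^ 2 ≤ g z := by
  have hder := hasDerivAt_comp_line hd x (z - x) 0
  simp only [zero_smul, add_zero] at hder
  have hlim := hder.tendsto_slope_zero_right
  simp only [zero_add, zero_smul, add_zero, smul_eq_mul] at hlim
  have hlim2 : Tendsto (fun t : ℝ => g z - g x - (1 - t) * (α / 2 * ‖z - x‖ ^ 2)) (𝓝[>] 0)
      (𝓝 (g z - g x - (1 - 0) * (α / 2 * ‖z - x‖ ^ 2))) := by
    refine Tendsto.mono_left (Continuous.tendsto ?_ _) nhdsWithin_le_nhds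
    fun_prop
  -- Divide the strong convexity inequality on the segment by `t` and let `t` decrease to `0`.
  have hle := le_of_tendsto_of_tendsto hlim hlim2 ?_
  · linarith
  · filter_upwards [Ioo_mem_nhdsGT (zero_lt_one' ℝ)] with t ht
    have h := hg.2 (Set.mem_univ x) (Set.mem_univ z) (sub_nonneg.2 ht.2.le) ht.1.le (by ring)
    have e : (1 - t) • x + t • z = x + t • (z - x) := by module
    rw [e, norm_sub_rev] at h
    simp only [smul_eq_mul] at h
    rw [inv_mul_le_iff₀ ht.1]
    nlinarith [h]

theorem le_quadratic_of_lipschitz_gradient {g : E → ℝ} {β : ℝ} (hd : Differentiable ℝ g)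
    (hg : ∀ x z, ‖gradient g x - gradient g z‖ ≤ β * ‖x - z‖) (x z : E) :
    g z ≤ g x + inner ℝ (gradient g x) (z - x) + β / 2 * ‖z - x‖ ^ 2 := by
  set d := z - x
  -- The defect of the quadratic model along the segment; the Lipschitz bound makes its derivative
  -- nonpositive.
  let φ : ℝ → ℝ := fun t => g (x + t • d) - t * inner ℝ (gradient g x) d - t ^ 2 * (β / 2 * ‖d‖ ^ 2)
  have hφ : ∀ t, HasDerivAt φ (inner ℝ (gradient g (x + t • d)) d - inner ℝ (gradient g x) d
      - 2 * t * (β / 2 * ‖d‖ ^ 2)) t := by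
    intro t
    refine ((hasDerivAt_comp_line hd x d t).sub ?_).sub ?_
    · simpa using (hasDerivAt_id t).mul_const (inner ℝ (gradient g x) d)
    · simpa using (hasDerivAt_pow 2 t).mul_const (β / 2 * ‖d‖ ^ 2)
  have hanti : AntitoneOn φ (Set.Icc 0 1) := by
    refine antitoneOn_of_deriv_nonpos (convex_Icc 0 1)
      (fun t _ => (hφ t).continuousAt.continuousWithinAt)
      (fun t _ => (hφ t).differentiableAt.differentiableWithinAt) fun t ht => ?_
    rw [interior_Icc] at ht
    rw [(hφ t).deriv, ← inner_sub_left]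
    have h1 := real_inner_le_norm (gradient g (x + t • d) - gradient g x) d
    have h2 := hg (x + t • d) x
    rw [add_sub_cancel_left, norm_smul, Real.norm_of_nonneg ht.1.le] at h2
    nlinarith [mul_le_mul_of_nonneg_right h2 (norm_nonneg d)]
  have h := hanti (Set.left_mem_Icc.2 zero_le_one) (Set.right_mem_Icc.2 zero_le_one) zero_le_one
  simp only [φ, one_smul, zero_smul, add_zero, d, add_sub_cancel] at h
  linarith

end Calculus

/-! ### Rank-one matrices, the spectrahedron and eigenvalue gaps. -/

section Matrix

variable {n : ℕ}

/-- The linear operator of a symmetric matrix. -/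
noncomputable abbrev Sym.toLin (M : Sym n) : Vec n →ₗ[ℝ] Vec n := Matrix.toEuclideanLin M.toMat

theorem Sym.isSymmetric (M : Sym n) : M.toLin.IsSymmetric :=
  Matrix.isSymmetric_toEuclideanLin_iff.mpr M.isHermitian

theorem Sym.toMat_outer (v : Vec n) : (outer v).toMat = Matrix.vecMulVec v v := rfl

theorem Sym.toMat_add (X Y : Sym n) : (X + Y).toMat = X.toMat + Y.toMat := rfl

theorem Sym.toMat_smul (a : ℝ) (X : Sym n) : (a • X).toMat = a • X.toMat := rfl

theorem Sym.toMat_neg (X : Sym n) : (-X).toMat = -X.toMat := rfl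

theorem Sym.continuous_toMat : Continuous (Sym.toMat (n := n)) := by
  refine continuous_pi fun i => continuous_pi fun j => ?_
  simp only [Sym.toMat, Matrix.of_apply]
  fun_prop

theorem inner_outer (M : Sym n) (z : Vec n) : inner ℝ M (outer z) = inner ℝ z (M.toLin z) := by
  rw [Sym.inner_eq_trace, Sym.toMat_outer, Matrix.mul_vecMulVec, Matrix.trace_vecMulVec,
    Matrix.toLpLin_apply, EuclideanSpace.inner_eq_star_dotProduct]
  simp

theorem inner_outer_outer (x z : Vec n) : inner ℝ (outer x) (outer z) = inner ℝ x z ^ 2 := by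
  rw [Sym.inner_eq_trace, Sym.toMat_outer, Sym.toMat_outer, Matrix.vecMulVec_mul_vecMulVec,
    Matrix.trace_vecMulVec, EuclideanSpace.inner_eq_star_dotProduct]
  simp [dotProduct_comm, sq]

theorem trace_outer (z : Vec n) : (outer z).toMat.trace = ‖z‖ ^ 2 := by
  rw [Sym.toMat_outer, Matrix.trace_vecMulVec, ← real_inner_self_eq_norm_sq,
    EuclideanSpace.inner_eq_star_dotProduct]
  simp

theorem norm_outer (z : Vec n) : ‖outer z‖ = ‖z‖ ^ 2 := by
  have h : ‖outer z‖ ^ 2 = (‖z‖ ^ 2) ^ 2 := by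
    rw [← real_inner_self_eq_norm_sq, inner_outer_outer, real_inner_self_eq_norm_sq]
  exact (pow_left_inj₀ (norm_nonneg _) (by positivity) two_ne_zero).1 h

theorem outer_mem_spectrahedron {z : Vec n} (hz : ‖z‖ = 1) : outer z ∈ spectrahedron n := by
  refine ⟨?_, by rw [trace_outer, hz, one_pow]⟩
  simpa [Sym.toMat_outer] using Matrix.posSemidef_vecMulVec_self_star (z : Fin n → ℝ)

theorem exists_eq_sum_outer {X : Sym n} (hX : X ∈ spectrahedron n) :
    ∃ (m : ℕ) (w : Fin m → Vec n), X = ∑ i, outer (w i) ∧ ∑ i, ‖w i‖ ^ 2 = 1 := by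
  obtain ⟨m, w, hw⟩ := Matrix.posSemidef_iff_eq_sum_vecMulVec.1 hX.1
  have hX' : X = ∑ i, outer (WithLp.toLp 2 (w i)) := by
    ext ⟨i, j⟩
    have := congrFun (congrFun hw i) j
    simp only [Sym.toMat, Matrix.of_apply, Matrix.sum_apply, Matrix.vecMulVec_apply] at this
    rw [this]
    simp [outer, WithLp.ofLp_sum]
  refine ⟨m, fun i => WithLp.toLp 2 (w i), hX', ?_⟩
  rw [← hX.2, hw, Matrix.trace_sum]
  refine Finset.sum_congr rfl fun i _ => ?_
  rw [← trace_outer, Sym.toMat_outer]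
  simp

/-- Reduces linear bounds on the spectrahedron to quadratic forms: its points are sums of rank-one
matrices of total trace one. -/
theorem le_inner_of_forall_le {M X : Sym n} {c : ℝ} (hX : X ∈ spectrahedron n)
    (h : ∀ z, c * ‖z‖ ^ 2 ≤ inner ℝ M (outer z)) : c ≤ inner ℝ M X := by
  obtain ⟨m, w, rfl, hw⟩ := exists_eq_sum_outer hX
  calc c = ∑ i, c * ‖w i‖ ^ 2 := by rw [← Finset.mul_sum, hw, mul_one]
    _ ≤ ∑ i, inner ℝ M (outer (w i)) := Finset.sum_le_sum fun i _ => h _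
    _ = _ := by rw [inner_sum]

theorem norm_le_one_of_mem_spectrahedron {X : Sym n} (hX : X ∈ spectrahedron n) : ‖X‖ ≤ 1 := by
  obtain ⟨m, w, rfl, hw⟩ := exists_eq_sum_outer hX
  calc _ ≤ ∑ i, ‖outer (w i)‖ := norm_sum_le _ _
    _ = 1 := by simp_rw [norm_outer, hw]

theorem convex_spectrahedron (n : ℕ) : Convex ℝ (spectrahedron n) := by
  intro X hX Y hY a b ha hb hab
  refine ⟨?_, ?_⟩
  · rw [Sym.toMat_add, Sym.toMat_smul, Sym.toMat_smul]
    exact (hX.1.smul ha).add (hY.1.smul hb)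
  · rw [Sym.toMat_add, Sym.toMat_smul, Sym.toMat_smul, Matrix.trace_add, Matrix.trace_smul,
      Matrix.trace_smul, hX.2, hY.2]
    simpa using hab

theorem isCompact_spectrahedron (n : ℕ) : IsCompact (spectrahedron n) := by
  refine Metric.isCompact_of_isClosed_isBounded ?_ ?_
  -- Closedness: positive semidefiniteness is an intersection of closed half-spaces indexed by `z`.
  · have h : spectrahedron n = (⋂ z : Vec n, {X : Sym n | 0 ≤ inner ℝ X (outer z)}) ∩
        {X : Sym n | X.toMat.trace = 1} := by
      ext X
      refine and_congr_left fun _ => ?_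
      rw [Set.mem_iInter]
      constructor
      · intro hX z
        rw [Set.mem_ofPred_eq, inner_outer, Matrix.toLpLin_apply,
          EuclideanSpace.inner_eq_star_dotProduct]
        simpa [dotProduct_comm] using hX.dotProduct_mulVec_nonneg (z : Fin n → ℝ)
      · intro hX
        refine Matrix.PosSemidef.of_dotProduct_mulVec_nonneg X.isHermitian fun z => ?_
        have := hX (WithLp.toLp 2 z)
        rw [Set.mem_ofPred_eq, inner_outer, Matrix.toLpLin_apply,
          EuclideanSpace.inner_eq_star_dotProduct] at this
        simpa [dotProduct_comm] using this
    rw [h]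
    refine (isClosed_iInter fun z => isClosed_le continuous_const (by fun_prop)).inter
      (isClosed_eq ?_ continuous_const)
    exact Sym.continuous_toMat.matrix_trace
  · exact (Metric.isBounded_closedBall (x := (0 : Sym n)) (r := 1)).subset fun X hX => by
      simpa using norm_le_one_of_mem_spectrahedron hX

theorem inner_toLin_self_eq_sum (M : Sym n) (z : Vec n) :
    inner ℝ M (outer z) = ∑ i, M.isSymmetric.eigenvalues finrank_euclideanSpace i *
      inner ℝ (M.isSymmetric.eigenvectorBasis finrank_euclideanSpace i) z ^ 2 := by
  rw [inner_outer, ← OrthonormalBasis.sum_inner_mul_inner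
    (M.isSymmetric.eigenvectorBasis finrank_euclideanSpace)]
  refine Finset.sum_congr rfl fun i _ => ?_
  rw [← M.isSymmetric _ z, LinearMap.IsSymmetric.apply_eigenvectorBasis, inner_smul_left,
    real_inner_comm]
  simp
  ring

theorem norm_sq_eq_sum (M : Sym n) (z : Vec n) :
    ‖z‖ ^ 2 = ∑ i, inner ℝ (M.isSymmetric.eigenvectorBasis finrank_euclideanSpace i) z ^ 2 := by
  rw [← real_inner_self_eq_norm_sq, ← OrthonormalBasis.sum_inner_mul_inner
    (M.isSymmetric.eigenvectorBasis finrank_euclideanSpace)]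
  refine Finset.sum_congr rfl fun i _ => ?_
  rw [real_inner_comm, sq]

/-- The linear minimization oracle of Frank-Wolfe. The eigenvector equation is kept because the
local analysis needs it in addition to minimality. -/
theorem IsLeadingEigenvector.exists_of_neg {G : Sym n} {v : Vec n}
    (h : IsLeadingEigenvector (-G) v) :
    ∃ μ : ℝ, G.toLin v = μ • v ∧ ∀ X ∈ spectrahedron n, μ ≤ inner ℝ G X := by
  obtain ⟨-, μ, hv, hμ⟩ := h
  refine ⟨-μ, ?_, fun X hX => le_inner_of_forall_le hX fun z => ?_⟩
  · rw [Sym.toMat_neg, map_neg, LinearMap.neg_apply] at hv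
    rw [neg_smul, ← hv, neg_neg]
  · have h1 := inner_toLin_self_eq_sum (-G) z
    rw [inner_neg_left] at h1
    have h2 : -inner ℝ G (outer z) ≤ μ * ‖z‖ ^ 2 := by
      rw [h1, norm_sq_eq_sum (-G) z, Finset.mul_sum]
      exact Finset.sum_le_sum fun i _ => mul_le_mul_of_nonneg_right
        (hμ _ ((-G).isSymmetric.hasEigenvalue_eigenvalues _ i)) (sq_nonneg _)
    linarith

theorem inner_outer_of_eigenvector {G : Sym n} {v : Vec n} {μ : ℝ} (hv : ‖v‖ = 1)
    (h : G.toLin v = μ • v) : inner ℝ G (outer v) = μ := by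
  rw [inner_outer, h, inner_smul_right, real_inner_self_eq_norm_sq, hv, one_pow, mul_one]

/-- Expand in an orthonormal eigenbasis: `‖z‖ ^ 2 - inner ℝ x z ^ 2` is the mass of `z` off the last
eigenvector `x`, and every other eigenvalue is at least `l + δ`. -/
theorem exists_of_eigGap_eq {hn : 2 ≤ n} {G : Sym n} {δ : ℝ} (h : eigGap hn G = δ) :
    ∃ (x : Vec n) (l : ℝ), ‖x‖ = 1 ∧ inner ℝ G (outer x) = l ∧
      ∀ z, l * ‖z‖ ^ 2 + δ * (‖z‖ ^ 2 - inner ℝ x z ^ 2) ≤ inner ℝ G (outer z) := by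
  set e := G.isSymmetric.eigenvectorBasis finrank_euclideanSpace with he
  set c : Fin n → Fin (Fintype.card (Fin n)) := Fin.cast (Fintype.card_fin n).symm
  set k : Fin (Fintype.card (Fin n)) := c ⟨n - 1, by omega⟩ with hk
  have hl : ∀ i, eigval G i = G.isSymmetric.eigenvalues finrank_euclideanSpace (c i) := fun i => rfl
  refine ⟨e k, eigval G ⟨n - 1, by omega⟩, e.orthonormal.1 k,
    inner_outer_of_eigenvector (e.orthonormal.1 k) ?_, fun z => ?_⟩
  · exact G.isSymmetric.apply_eigenvectorBasis _ _
  · rw [inner_toLin_self_eq_sum, norm_sq_eq_sum G z, ← he]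
    have h1 : ∑ i, inner ℝ (e i) z ^ 2 - inner ℝ (e k) z ^ 2
        = ∑ i, if i = k then 0 else inner ℝ (e i) z ^ 2 := by
      rw [sub_eq_iff_eq_add, ← Finset.sum_erase_add _ _ (Finset.mem_univ k), add_left_inj,
        ← Finset.sum_erase_add _ _ (Finset.mem_univ k), if_pos rfl, add_zero]
      exact Finset.sum_congr rfl fun i hi => (if_neg (Finset.ne_of_mem_erase hi)).symm
    rw [h1, Finset.mul_sum, Finset.mul_sum, ← Finset.sum_add_distrib]
    refine Finset.sum_le_sum fun i _ => ?_
    split_ifs with hi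
    · rw [hi, hl, mul_zero, add_zero]
    · rw [← add_mul]
      refine mul_le_mul_of_nonneg_right ?_ (sq_nonneg _)
      have h2 : eigval G ⟨n - 2, by omega⟩ ≤ G.isSymmetric.eigenvalues finrank_euclideanSpace i := by
        rw [hl]
        refine G.isSymmetric.eigenvalues_antitone _ ?_
        have h3 : (i : ℕ) ≠ n - 1 := fun h' => hi (Fin.ext h')
        have h4 : (i : ℕ) < n := by simpa using i.2
        rw [Fin.le_def]
        change (i : ℕ) ≤ n - 2
        omega
      rw [eigGap] at h
      linarith

end Matrix

end FWMix

/-! ### Perturbation of the smallest eigenvector under a gap. -/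

namespace FWMix

variable {n : ℕ}

theorem Sym.inner_smul_left (a : ℝ) (X Y : Sym n) : inner ℝ (a • X) Y = a * inner ℝ X Y :=
  real_inner_smul_left X Y a

theorem Sym.inner_smul_right (a : ℝ) (X Y : Sym n) : inner ℝ X (a • Y) = a * inner ℝ X Y :=
  real_inner_smul_right X Y a

theorem add_mul_le_inner_of_gap {G X : Sym n} {x : Vec n} {l δ : ℝ} (hX : X ∈ spectrahedron n)
    (hG : ∀ z, l * ‖z‖ ^ 2 + δ * (‖z‖ ^ 2 - inner ℝ x z ^ 2) ≤ inner ℝ G (outer z)) :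
    l + δ * (1 - inner ℝ (outer x) X) ≤ inner ℝ G X := by
  -- Shifting by `δ x xᵀ` lifts the quadratic form to at least `l + δ` on unit vectors.
  have h : l + δ ≤ inner ℝ (G + δ • outer x) X := le_inner_of_forall_le hX fun z => by
    rw [inner_add_left, Sym.inner_smul_left, inner_outer_outer]
    linarith [hG z]
  rw [inner_add_left, Sym.inner_smul_left] at h
  linarith

theorem norm_outer_sub_outer_sq {v x : Vec n} (hv : ‖v‖ = 1) (hx : ‖x‖ = 1) :
    ‖outer v - outer x‖ ^ 2 = 2 * (1 - inner ℝ x v ^ 2) := by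
  rw [norm_sub_sq_real, norm_outer, norm_outer, inner_outer_outer, hv, hx, real_inner_comm]
  ring

/-- A sin-theta bound for the leading eigenvector. -/
theorem norm_sub_le_of_sharp {G G' X V : Sym n} {δ : ℝ}
    (hsharp : δ / 2 * ‖V - X‖ ^ 2 ≤ inner ℝ G (V - X)) (hV : inner ℝ G' V ≤ inner ℝ G' X) :
    δ / 2 * ‖V - X‖ ≤ ‖G' - G‖ := by
  have h1 := real_inner_le_norm (G - G') (V - X)
  rw [inner_sub_left, norm_sub_rev G G'] at h1
  have h2 : inner ℝ G' (V - X) ≤ 0 := by rw [inner_sub_right]; linarith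
  rcases (norm_nonneg (V - X)).eq_or_lt with h0 | h0
  · rw [← h0, mul_zero]; exact norm_nonneg _
  · exact le_of_mul_le_mul_right (by nlinarith) h0

/-- Estimating `G' - G` against `v vᵀ - x xᵀ` directly would leave an error only linear in the
distance. Since `v` is an eigenvector of `G'`, the quantity equals `(1 - c²) μ` minus the form of
`G'` at the component `u` of `x` orthogonal to `v`. As `‖u‖² = 1 - c²`, the perturbation enters at
the quadratic scale. -/
theorem inner_outer_sub_le_of_near {G G' : Sym n} {v x : Vec n} {l μ δ : ℝ} (hδ : 0 < δ)
    (hv : ‖v‖ = 1) (hx : ‖x‖ = 1) (hl : inner ℝ G (outer x) = l)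
    (hG : ∀ z, l * ‖z‖ ^ 2 + δ * (‖z‖ ^ 2 - inner ℝ x z ^ 2) ≤ inner ℝ G (outer z))
    (hμ : G'.toLin v = μ • v) (hmin : μ ≤ inner ℝ G' (outer x)) (hε : 8 * ‖G' - G‖ ≤ δ) :
    inner ℝ G' (outer v - outer x) ≤ -(δ / 4) * ‖outer v - outer x‖ ^ 2 := by
  have hμ' := inner_outer_of_eigenvector hv hμ
  have hN := norm_outer_sub_outer_sq hv hx
  have hsharp : δ / 2 * ‖outer v - outer x‖ ^ 2 ≤ inner ℝ G (outer v - outer x) := by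
    have := hG v
    rw [hv] at this
    rw [inner_sub_right, hl, hN]
    linarith
  have hclose := norm_sub_le_of_sharp (G' := G') hsharp (by rw [hμ']; exact hmin)
  have hclose' : ‖outer v - outer x‖ ≤ 1 / 4 := by
    refine le_of_mul_le_mul_left (a := δ / 2) ?_ (by positivity)
    linarith
  set c : ℝ := inner ℝ x v with hc
  have hs : 2 * (1 - c ^ 2) ≤ 1 / 16 := by
    rw [← hN]; nlinarith [norm_nonneg (outer v - outer x)]
  have hs0 : 0 ≤ 1 - c ^ 2 := by nlinarith [sq_nonneg ‖outer v - outer x‖]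
  set u : Vec n := x - c • v with hu
  have hvv : inner ℝ v v = (1 : ℝ) := by rw [real_inner_self_eq_norm_sq, hv, one_pow]
  have hxx : inner ℝ x x = (1 : ℝ) := by rw [real_inner_self_eq_norm_sq, hx, one_pow]
  have hvx : inner ℝ v x = c := real_inner_comm _ _
  have hunorm : ‖u‖ ^ 2 = 1 - c ^ 2 := by
    rw [← real_inner_self_eq_norm_sq, hu]
    simp only [inner_sub_left, inner_sub_right, inner_smul_left, inner_smul_right, hvv, hxx, hvx,
      ← hc, conj_trivial]
    ring
  have hxu : inner ℝ x u = 1 - c ^ 2 := by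
    rw [hu, inner_sub_right, inner_smul_right, hxx, ← hc]; ring
  have hqu : inner ℝ G' (outer u) = inner ℝ G' (outer x) - c ^ 2 * μ := by
    have h1 : inner ℝ v (G'.toLin x) = μ * c := by
      rw [← G'.isSymmetric, hμ, inner_smul_left, hvx, conj_trivial]
    simp only [inner_outer, hu, map_sub, map_smul, inner_sub_left, inner_sub_right,
      inner_smul_left, inner_smul_right, hμ, h1, hvv, ← hc, conj_trivial]
    ring
  have hGu := hG u
  rw [hunorm, hxu] at hGu
  have hEu := real_inner_le_norm (G - G') (outer u)
  rw [inner_sub_left, norm_outer, hunorm, norm_sub_rev] at hEu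
  have hEx := real_inner_le_norm (G' - G) (outer x)
  rw [inner_sub_left, norm_outer, hx, hl] at hEx
  rw [inner_sub_right, hμ', hN]
  have hμl : (1 - c ^ 2) * μ ≤ (1 - c ^ 2) * (l + δ / 8) :=
    mul_le_mul_of_nonneg_left (by linarith) hs0
  have h3 : ‖G' - G‖ * (1 - c ^ 2) ≤ δ / 8 * (1 - c ^ 2) :=
    mul_le_mul_of_nonneg_right (by linarith) hs0
  have h4 : δ * (1 - c ^ 2) ^ 2 ≤ δ * (1 - c ^ 2) * (1 / 32) := by
    rw [sq, ← mul_assoc]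
    exact mul_le_mul_of_nonneg_left (by linarith) (by positivity)
  have h5 : 0 ≤ δ * (1 - c ^ 2) := by positivity
  linarith

/-! ### Models of the objective, optimality conditions and quadratic growth. -/

namespace Problem

variable {p : ℕ} {P : Problem n p} {α β : ℝ}

/-- The standing assumptions on the data of the problem. -/
structure Regular (P : Problem n p) (α β : ℝ) : Prop where
  α_pos : 0 < α
  β_pos : 0 < β
  strong : StrongConvexOn Set.univ α P.g
  smooth : IsSmooth β P.g
  convex : Convex ℝ P.K
  compact : IsCompact P.K

theorem gradX_eq (hd : Differentiable ℝ P.g) (X : Sym n) (y : Vec p) :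
    P.gradX X y = ContinuousLinearMap.adjoint P.A (gradient P.g (P.A X + y)) + P.C := by
  refine HasGradientAt.gradient (hasGradientAt_iff_hasFDerivAt.2 ?_)
  have h1 : HasFDerivAt (fun Z : Sym n => P.A Z + y) P.A X := P.A.hasFDerivAt.add_const y
  have h2 := ((hd (P.A X + y)).hasGradientAt.hasFDerivAt).comp X h1
  have h3 : HasFDerivAt (fun Z : Sym n => inner ℝ P.C Z) (innerSL ℝ P.C) X :=
    (innerSL ℝ P.C).hasFDerivAt
  refine ((h2.add h3).add_const (inner ℝ P.c y)).congr_fderiv ?_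
  ext Z
  simp [ContinuousLinearMap.adjoint_inner_left]

theorem gradY_eq (hd : Differentiable ℝ P.g) (X : Sym n) (y : Vec p) :
    P.gradY X y = gradient P.g (P.A X + y) + P.c := by
  refine HasGradientAt.gradient (hasGradientAt_iff_hasFDerivAt.2 ?_)
  have h1 : HasFDerivAt (fun z : Vec p => P.A X + z) (ContinuousLinearMap.id ℝ (Vec p)) y :=
    (hasFDerivAt_id y).const_add _
  have h2 := ((hd (P.A X + y)).hasGradientAt.hasFDerivAt).comp y h1
  have h3 : HasFDerivAt (fun z : Vec p => inner ℝ P.c z) (innerSL ℝ P.c) y :=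
    (innerSL ℝ P.c).hasFDerivAt
  refine ((h2.add_const (inner ℝ P.C X)).add h3).congr_fderiv ?_
  ext z
  simp

theorem inner_grad_add (hd : Differentiable ℝ P.g) (X Z : Sym n) (y w : Vec p) :
    inner ℝ (P.gradX X y) Z + inner ℝ (P.gradY X y) w =
      inner ℝ (gradient P.g (P.A X + y)) (P.A Z + w) + inner ℝ P.C Z + inner ℝ P.c w := by
  rw [gradX_eq hd, gradY_eq hd, inner_add_left, inner_add_left, inner_add_right,
    ContinuousLinearMap.adjoint_inner_left]
  ring

theorem image_sub (X X' : Sym n) (y y' : Vec p) :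
    P.A X' + y' - (P.A X + y) = P.A (X' - X) + (y' - y) := by
  rw [map_sub]; abel

theorem Regular.f_lower (hP : P.Regular α β) (X X' : Sym n) (y y' : Vec p) :
    P.f X y + inner ℝ (P.gradX X y) (X' - X) + inner ℝ (P.gradY X y) (y' - y)
      + α / 2 * ‖P.A (X' - X) + (y' - y)‖ ^ 2 ≤ P.f X' y' := by
  have h := first_order_of_strongConvexOn hP.smooth.1 hP.strong (P.A X + y) (P.A X' + y')
  have h2 := inner_grad_add hP.smooth.1 X (X' - X) y (y' - y)
  rw [image_sub] at h
  simp only [f]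
  rw [inner_sub_right P.C, inner_sub_right P.c] at h2
  linarith

/-- Splitting `‖a + b‖² ≤ 2‖a‖² + 2‖b‖²` doubles `β / 2` but decouples the variables; this is why
the projection step has length `1 / (2β)`. -/
theorem Regular.f_upper (hP : P.Regular α β) (X X' : Sym n) (y y' : Vec p) :
    P.f X' y' ≤ P.f X y + inner ℝ (P.gradX X y) (X' - X) + inner ℝ (P.gradY X y) (y' - y)
      + β * ‖P.A (X' - X)‖ ^ 2 + β * ‖y' - y‖ ^ 2 := by
  have h := le_quadratic_of_lipschitz_gradient hP.smooth.1 hP.smooth.2 (P.A X + y) (P.A X' + y')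
  have h2 := inner_grad_add hP.smooth.1 X (X' - X) y (y' - y)
  rw [image_sub] at h
  have h3 : ‖P.A (X' - X) + (y' - y)‖ ^ 2 ≤ 2 * (‖P.A (X' - X)‖ ^ 2 + ‖y' - y‖ ^ 2) :=
    (pow_le_pow_left₀ (norm_nonneg _) (norm_add_le _ _) 2).trans add_sq_le
  have h4 := mul_le_mul_of_nonneg_left h3 (half_pos hP.β_pos).le
  simp only [f]
  rw [inner_sub_right P.C, inner_sub_right P.c] at h2
  linarith

theorem Regular.norm_gradX_sub_le (hP : P.Regular α β) (X X' : Sym n) (y y' : Vec p) :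
    ‖P.gradX X' y' - P.gradX X y‖ ≤ ‖P.A‖ * (β * ‖P.A (X' - X) + (y' - y)‖) := by
  rw [gradX_eq hP.smooth.1, gradX_eq hP.smooth.1, add_sub_add_right_eq_sub, ← map_sub]
  refine (ContinuousLinearMap.le_opNorm _ _).trans ?_
  rw [LinearIsometryEquiv.norm_map, ← image_sub]
  exact mul_le_mul_of_nonneg_left (hP.smooth.2 _ _) (norm_nonneg P.A)

theorem Regular.exists_isOptimal (hP : P.Regular α β) {X₀ : Sym n} {y₀ : Vec p}
    (hX₀ : X₀ ∈ spectrahedron n) (hy₀ : y₀ ∈ P.K) : ∃ X y, P.IsOptimal X y := by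
  have hc : Continuous fun w : Sym n × Vec p => P.f w.1 w.2 := by
    have := hP.smooth.1.continuous
    unfold f
    fun_prop
  obtain ⟨w, hw, hmin⟩ := ((isCompact_spectrahedron n).prod hP.compact).exists_isMinOn
    ⟨(X₀, y₀), hX₀, hy₀⟩ hc.continuousOn
  exact ⟨w.1, w.2, hw.1, hw.2, fun X' hX' y' hy' => hmin (Set.mk_mem_prod hX' hy')⟩

theorem IsOptimal.fstar_eq {X : Sym n} {y : Vec p} (h : P.IsOptimal X y) : P.fstar = P.f X y :=
  IsLeast.csInf_eq ⟨⟨(X, y), ⟨h.1, h.2.1⟩, rfl⟩, by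
    rintro _ ⟨w, hw, rfl⟩
    exact h.2.2 _ hw.1 _ hw.2⟩

theorem IsOptimal.inner_nonneg {X : Sym n} {y : Vec p} (h : P.IsOptimal X y)
    (hP : P.Regular α β) {X' : Sym n} {y' : Vec p} (hX' : X' ∈ spectrahedron n) (hy' : y' ∈ P.K) :
    0 ≤ inner ℝ (P.gradX X y) (X' - X) + inner ℝ (P.gradY X y) (y' - y) := by
  set D := inner ℝ (P.gradX X y) (X' - X) + inner ℝ (P.gradY X y) (y' - y) with hD
  set Q := β * ‖P.A (X' - X)‖ ^ 2 + β * ‖y' - y‖ ^ 2 with hQ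
  have key : ∀ t ∈ Set.Ioo (0 : ℝ) 1, 0 ≤ D + t * Q := by
    intro t ht
    have h1 : X + t • (X' - X) ∈ spectrahedron n :=
      (convex_spectrahedron n).add_smul_sub_mem h.1 hX' ⟨ht.1.le, ht.2.le⟩
    have h2 : y + t • (y' - y) ∈ P.K := hP.convex.add_smul_sub_mem h.2.1 hy' ⟨ht.1.le, ht.2.le⟩
    have h3 := hP.f_upper X (X + t • (X' - X)) y (y + t • (y' - y))
    have h4 := h.2.2 _ h1 _ h2
    simp only [add_sub_cancel_left, map_smul, norm_smul, inner_smul_right, mul_pow,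
      Real.norm_eq_abs, sq_abs, Sym.inner_smul_right] at h3
    refine nonneg_of_mul_nonneg_right (a := t) ?_ ht.1
    rw [hD, hQ]
    linarith
  have hlim : Tendsto (fun t : ℝ => D + t * Q) (𝓝[>] 0) (𝓝 (D + 0 * Q)) := by
    refine Tendsto.mono_left (Continuous.tendsto ?_ _) nhdsWithin_le_nhds
    fun_prop
  rw [zero_mul, add_zero] at hlim
  exact ge_of_tendsto hlim (by
    filter_upwards [Ioo_mem_nhdsGT (zero_lt_one' ℝ)] with t ht using key t ht)

/-- Under the gap assumption an optimal solution is the rank-one projection onto the eigenline of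
the smallest eigenvalue of the gradient. -/
theorem IsOptimal.exists_outer {Xs : Sym n} {ys : Vec p} (h : P.IsOptimal Xs ys)
    (hP : P.Regular α β) {hn : 2 ≤ n} {δ : ℝ} (hδ : P.GapAssumption hn δ) :
    ∃ (x : Vec n) (l : ℝ), ‖x‖ = 1 ∧ Xs = outer x ∧ inner ℝ (P.gradX Xs ys) (outer x) = l ∧
      ∀ z, l * ‖z‖ ^ 2 + δ * (‖z‖ ^ 2 - inner ℝ x z ^ 2) ≤ inner ℝ (P.gradX Xs ys) (outer z) := by
  obtain ⟨x, l, hx, hl, hG⟩ := exists_of_eigGap_eq (hδ.2 Xs ys h)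
  refine ⟨x, l, hx, ?_, hl, hG⟩
  have h1 := add_mul_le_inner_of_gap h.1 hG
  have h2 := h.inner_nonneg hP (outer_mem_spectrahedron hx) h.2.1
  rw [sub_self, inner_zero_right, add_zero, inner_sub_right, hl] at h2
  have h3 : 1 ≤ inner ℝ (outer x) Xs := le_of_mul_le_mul_left (by linarith) hδ.1
  -- Both matrices have Frobenius norm at most one, so inner product at least one forces equality.
  have h4 : ‖outer x - Xs‖ ^ 2 ≤ 0 := by
    rw [norm_sub_sq_real, norm_outer, hx]
    nlinarith [norm_le_one_of_mem_spectrahedron h.1, norm_nonneg Xs]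
  exact (sub_eq_zero.1 (norm_eq_zero.1 (pow_eq_zero_iff two_ne_zero |>.1
    (le_antisymm h4 (sq_nonneg _))))).symm

theorem IsOptimal.sharp {Xs : Sym n} {ys : Vec p} (h : P.IsOptimal Xs ys)
    (hP : P.Regular α β) {hn : 2 ≤ n} {δ : ℝ} (hδ : P.GapAssumption hn δ) {X : Sym n}
    (hX : X ∈ spectrahedron n) :
    δ / 2 * ‖X - Xs‖ ^ 2 ≤ inner ℝ (P.gradX Xs ys) (X - Xs) := by
  obtain ⟨x, l, hx, rfl, hl, hG⟩ := h.exists_outer hP hδ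
  have h1 := add_mul_le_inner_of_gap hX hG
  have h2 : ‖X - outer x‖ ^ 2 ≤ 2 * (1 - inner ℝ (outer x) X) := by
    rw [norm_sub_sq_real, norm_outer, hx, real_inner_comm]
    nlinarith [norm_le_one_of_mem_spectrahedron hX, norm_nonneg X]
  rw [inner_sub_right, hl]
  nlinarith [mul_le_mul_of_nonneg_left h2 hδ.1.le]

/-- Quadratic growth. -/
theorem IsOptimal.growth {Xs : Sym n} {ys : Vec p} (h : P.IsOptimal Xs ys)
    (hP : P.Regular α β) {hn : 2 ≤ n} {δ : ℝ} (hδ : P.GapAssumption hn δ) {X : Sym n} {y : Vec p}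
    (hX : X ∈ spectrahedron n) (hy : y ∈ P.K) :
    δ / 2 * ‖X - Xs‖ ^ 2 + α / 2 * ‖P.A (X - Xs) + (y - ys)‖ ^ 2 ≤ P.f X y - P.f Xs ys := by
  have h1 := h.sharp hP hδ hX
  have h2 := h.inner_nonneg hP h.1 hy
  rw [sub_self, inner_zero_right, zero_add] at h2
  linarith [hP.f_lower Xs X ys y]

theorem IsOptimal.norm_y_sub_sq_le {Xs : Sym n} {ys : Vec p} (h : P.IsOptimal Xs ys)
    (hP : P.Regular α β) {hn : 2 ≤ n} {δ : ℝ} (hδ : P.GapAssumption hn δ) {X : Sym n} {y : Vec p}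
    (hX : X ∈ spectrahedron n) (hy : y ∈ P.K) :
    ‖y - ys‖ ^ 2 ≤ 2 * (‖P.A‖ ^ 2 / δ + 1 / α) * (P.f X y - P.f Xs ys) := by
  have h1 := h.growth hP hδ hX hy
  have hα := hP.α_pos
  have hδ0 := hδ.1
  set r := ‖X - Xs‖
  set b := ‖P.A (X - Xs) + (y - ys)‖
  have h2 : ‖y - ys‖ ≤ b + ‖P.A‖ * r := by
    have e : y - ys = P.A (X - Xs) + (y - ys) - P.A (X - Xs) := by abel
    rw [e]
    exact (norm_sub_le _ _).trans (add_le_add le_rfl (P.A.le_opNorm _))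
  -- Cauchy-Schwarz with weights `δ` and `α`; the defect is an explicit square.
  have h3 : (b + ‖P.A‖ * r) ^ 2 ≤ (‖P.A‖ ^ 2 / δ + 1 / α) * (δ * r ^ 2 + α * b ^ 2) := by
    have e : (‖P.A‖ ^ 2 / δ + 1 / α) * (δ * r ^ 2 + α * b ^ 2) - (b + ‖P.A‖ * r) ^ 2
        = (α * ‖P.A‖ * b - δ * r) ^ 2 / (α * δ) := by
      field_simp
      ring
    have : 0 ≤ (α * ‖P.A‖ * b - δ * r) ^ 2 / (α * δ) := by positivity
    linarith
  calc ‖y - ys‖ ^ 2 ≤ (b + ‖P.A‖ * r) ^ 2 := pow_le_pow_left₀ (norm_nonneg _) h2 2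
    _ ≤ (‖P.A‖ ^ 2 / δ + 1 / α) * (δ * r ^ 2 + α * b ^ 2) := h3
    _ ≤ (‖P.A‖ ^ 2 / δ + 1 / α) * (2 * (P.f X y - P.f Xs ys)) :=
        mul_le_mul_of_nonneg_left (by linarith) (by positivity)
    _ = _ := by ring

theorem IsOptimal.eq_of_gap {Xs X : Sym n} {ys y : Vec p} (h : P.IsOptimal Xs ys)
    (hP : P.Regular α β) {hn : 2 ≤ n} {δ : ℝ} (hδ : P.GapAssumption hn δ) (h' : P.IsOptimal X y) :
    X = Xs ∧ y = ys := by
  have h0 : P.f X y - P.f Xs ys = 0 := by rw [← h.fstar_eq, ← h'.fstar_eq, sub_self]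
  have h1 := h.growth hP hδ h'.1 h'.2.1
  have h2 := h.norm_y_sub_sq_le hP hδ h'.1 h'.2.1
  have hα := hP.α_pos
  have hδ0 := hδ.1
  rw [h0] at h1 h2
  rw [mul_zero] at h2
  constructor
  · have h3 : 0 ≤ α / 2 * ‖P.A (X - Xs) + (y - ys)‖ ^ 2 := by positivity
    have h4 : ‖X - Xs‖ ^ 2 ≤ 0 := by
      by_contra hc
      have := mul_pos (half_pos hδ0) (not_le.1 hc)
      linarith
    exact sub_eq_zero.1 (norm_eq_zero.1 (pow_eq_zero_iff two_ne_zero |>.1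
      (le_antisymm h4 (sq_nonneg _))))
  · exact sub_eq_zero.1 (norm_eq_zero.1 (pow_eq_zero_iff two_ne_zero |>.1
      (le_antisymm h2 (sq_nonneg _))))

/-- The gradient depends on `(X, y)` only through `𝒜 X + y`, so the strong convexity part of the
growth bound suffices and `δ` does not enter. -/
theorem IsOptimal.norm_gradX_sub_sq_le {Xs : Sym n} {ys : Vec p} (h : P.IsOptimal Xs ys)
    (hP : P.Regular α β) {hn : 2 ≤ n} {δ : ℝ} (hδ : P.GapAssumption hn δ) {X : Sym n} {y : Vec p}
    (hX : X ∈ spectrahedron n) (hy : y ∈ P.K) :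
    α * ‖P.gradX X y - P.gradX Xs ys‖ ^ 2 ≤ 2 * ‖P.A‖ ^ 2 * β ^ 2 * (P.f X y - P.f Xs ys) := by
  have hα := hP.α_pos
  have hδ0 := hδ.1
  have h1 := h.growth hP hδ hX hy
  have h2 : 0 ≤ δ / 2 * ‖X - Xs‖ ^ 2 := by positivity
  calc _ ≤ α * (‖P.A‖ * (β * ‖P.A (X - Xs) + (y - ys)‖)) ^ 2 :=
        mul_le_mul_of_nonneg_left
          (pow_le_pow_left₀ (norm_nonneg _) (hP.norm_gradX_sub_le Xs X ys y) 2) hα.le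
    _ = 2 * ‖P.A‖ ^ 2 * β ^ 2 * (α / 2 * ‖P.A (X - Xs) + (y - ys)‖ ^ 2) := by ring
    _ ≤ _ := mul_le_mul_of_nonneg_left (by linarith) (by positivity)

end Problem

end FWMix

/-! ### Arithmetic of the contraction rate. -/

namespace FWMix

theorem rate_le_sixth (α β δ a : ℝ) : rate α β δ a ≤ 1 / 6 := by
  unfold rate
  split_ifs <;> exact min_le_left _ _

theorem rate_pos {α β δ a : ℝ} (hα : 0 < α) (hβ : 0 < β) (hδ : 0 < δ) (ha : 0 ≤ a) :
    0 < rate α β δ a := by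
  unfold rate
  split_ifs with h
  · exact lt_min (by norm_num) (by positivity)
  · have : 0 < a := ha.lt_of_ne' h
    exact lt_min (by norm_num) (lt_min (by positivity) (by positivity))

/-- The product form also covers `a = 0`, where the third term of the minimum is absent. -/
theorem rate_mul_le_gap {α β δ a : ℝ} (hβ : 0 < β) (hδ : 0 < δ) :
    rate α β δ a * (72 * β * a ^ 2) ≤ δ := by
  by_cases h : a = 0
  · simp [h, hδ.le]
  · have h0 : 0 < 72 * β * a ^ 2 := by positivity
    rw [← le_div_iff₀ h0, rate, if_neg h]
    exact (min_le_right _ _).trans (min_le_right _ _)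

/-- The factor `6 * a ^ 2 / δ + 2 / α` is the coefficient of the optimality gap in the quadratic
error of the local step; the rest of the denominator is slack. -/
theorem rate_mul_le_one {α β δ a : ℝ} (hα : 0 < α) (hβ : 0 < β) (hδ : 0 < δ) (ha : 0 ≤ a) :
    rate α β δ a * (4 * β * (6 * a ^ 2 / δ + 2 / α)) ≤ 1 := by
  have h0 : 0 < 4 * β * (6 * α * δ * a ^ 2 + 4 * δ ^ 2 + 32 * a ^ 2 * β ^ 2) := by positivity
  have h1 : rate α β δ a ≤
      α * δ ^ 2 / (4 * β * (6 * α * δ * a ^ 2 + 4 * δ ^ 2 + 32 * a ^ 2 * β ^ 2)) := by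
    unfold rate
    split_ifs
    · exact min_le_right _ _
    · exact (min_le_right _ _).trans (min_le_left _ _)
  rw [le_div_iff₀ h0] at h1
  have e : rate α β δ a * (4 * β * (6 * a ^ 2 / δ + 2 / α)) =
      rate α β δ a * (4 * β * (6 * α * δ * a ^ 2 + 2 * δ ^ 2)) / (α * δ ^ 2) := by
    field_simp
  rw [e, div_le_one (by positivity)]
  refine le_trans (mul_le_mul_of_nonneg_left ?_ (rate_pos hα hβ hδ ha).le) h1
  refine mul_le_mul_of_nonneg_left ?_ (by positivity)
  have : 0 ≤ 32 * a ^ 2 * β ^ 2 := by positivity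
  linarith [sq_nonneg δ]

/-! ### One-step inequalities and the sublinear rate. -/

namespace Problem

variable {n p : ℕ} {P : Problem n p} {α β : ℝ}

namespace IsRun

variable {X : ℕ → Sym n} {y : ℕ → Vec p} {v : ℕ → Vec n} {η : ℕ → ℝ}

theorem outer_mem (hR : P.IsRun β X y v η) {t : ℕ} (ht : 1 ≤ t) :
    outer (v t) ∈ spectrahedron n :=
  outer_mem_spectrahedron (hR.v_step t ht).1

theorem mem (hR : P.IsRun β X y v η) {t : ℕ} (ht : 1 ≤ t) : X t ∈ spectrahedron n ∧ y t ∈ P.K := by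
  induction t, ht using Nat.le_induction with
  | base => exact ⟨hR.X_init, hR.y_init⟩
  | succ t ht ih =>
    refine ⟨?_, (hR.y_step t ht).1⟩
    rw [hR.X_step t ht]
    exact convex_spectrahedron n ih.1 (hR.outer_mem ht) (sub_nonneg.2 (hR.η_mem t ht).2)
      (hR.η_mem t ht).1 (by ring)

theorem inner_outer_le (hR : P.IsRun β X y v η) {t : ℕ} (ht : 1 ≤ t) {Z : Sym n}
    (hZ : Z ∈ spectrahedron n) :
    inner ℝ (P.gradX (X t) (y t)) (outer (v t)) ≤ inner ℝ (P.gradX (X t) (y t)) Z := by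
  obtain ⟨μ, h1, h2⟩ := (hR.v_step t ht).exists_of_neg
  rw [inner_outer_of_eigenvector (hR.v_step t ht).1 h1]
  exact h2 Z hZ

/-- Completing the square: projecting the gradient step minimizes the `y`-part of the upper model
over `K`. -/
theorem y_step_le (hR : P.IsRun β X y v η) (hβ : 0 < β) {t : ℕ} (ht : 1 ≤ t) {z : Vec p}
    (hz : z ∈ P.K) :
    inner ℝ (P.gradY (X t) (y t)) (y (t + 1) - y t) + β * ‖y (t + 1) - y t‖ ^ 2 ≤
      inner ℝ (P.gradY (X t) (y t)) (z - y t) + β * ‖z - y t‖ ^ 2 := by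
  have expand : ∀ w : Vec p, β * ‖y t - (1 / (2 * β)) • P.gradY (X t) (y t) - w‖ ^ 2 =
      inner ℝ (P.gradY (X t) (y t)) (w - y t) + β * ‖w - y t‖ ^ 2
        + ‖P.gradY (X t) (y t)‖ ^ 2 / (4 * β) := by
    intro w
    have e : y t - (1 / (2 * β)) • P.gradY (X t) (y t) - w =
        -((w - y t) + (1 / (2 * β)) • P.gradY (X t) (y t)) := by abel
    rw [e, norm_neg, norm_add_sq_real, norm_smul, inner_smul_right, mul_pow, Real.norm_eq_abs,
      sq_abs, real_inner_comm]
    field_simp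
    ring
  have h := mul_le_mul_of_nonneg_left
    (pow_le_pow_left₀ (norm_nonneg _) ((hR.y_step t ht).2 z hz) 2) hβ.le
  rw [expand, expand] at h
  linarith

theorem step_le (hR : P.IsRun β X y v η) (hP : P.Regular α β) {t : ℕ} (ht : 1 ≤ t) {z : Vec p}
    (hz : z ∈ P.K) {s : ℝ} (hs : s ∈ Set.Icc (0 : ℝ) 1) :
    P.f (X (t + 1)) (y (t + 1)) ≤ P.f (X t) (y t)
      + s * (inner ℝ (P.gradX (X t) (y t)) (outer (v t) - X t)
        + inner ℝ (P.gradY (X t) (y t)) (z - y t))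
      + β * s ^ 2 * (‖P.A (outer (v t) - X t)‖ ^ 2 + ‖z - y t‖ ^ 2) := by
  -- The competitor moves by the same fraction `s` in both blocks, although the algorithm chooses
  -- the two steps separately.
  have hw : y t + s • (z - y t) ∈ P.K := hP.convex.add_smul_sub_mem (hR.mem ht).2 hz hs
  have h1 := hR.y_step_le hP.β_pos ht hw
  have h2 := hR.η_min t ht s hs
  rw [← hR.X_step t ht] at h2
  have h3 := hP.f_upper (X t) ((1 - s) • X t + s • outer (v t)) (y t) (y (t + 1))
  have e : (1 - s) • X t + s • outer (v t) - X t = s • (outer (v t) - X t) := by module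
  rw [e] at h3
  simp only [add_sub_cancel_left, map_smul, norm_smul, inner_smul_right, mul_pow,
    Real.norm_eq_abs, sq_abs, Sym.inner_smul_right] at h1 h3
  linarith

theorem step_le_of_isOptimal (hR : P.IsRun β X y v η) (hP : P.Regular α β) {Xs : Sym n}
    {ys : Vec p} (h : P.IsOptimal Xs ys) {t : ℕ} (ht : 1 ≤ t) {s : ℝ}
    (hs : s ∈ Set.Icc (0 : ℝ) 1) :
    P.f (X (t + 1)) (y (t + 1)) - P.f Xs ys ≤ (1 - s) * (P.f (X t) (y t) - P.f Xs ys)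
      + s * inner ℝ (P.gradX (X t) (y t)) (outer (v t) - Xs)
      + β * s ^ 2 * (‖P.A (outer (v t) - X t)‖ ^ 2 + ‖ys - y t‖ ^ 2) := by
  have h1 := hR.step_le hP ht h.2.1 hs
  have h2 := hP.f_lower (X t) Xs (y t) ys
  have hα := hP.α_pos
  have h3 : 0 ≤ α / 2 * ‖P.A (Xs - X t) + (ys - y t)‖ ^ 2 := by positivity
  have h4 := mul_le_mul_of_nonneg_left (h2.trans' (le_add_of_nonneg_right h3)) hs.1
  rw [inner_sub_right] at h1 h4 ⊢
  linarith

theorem step_le_diam (hR : P.IsRun β X y v η) (hP : P.Regular α β) {Xs : Sym n}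
    {ys : Vec p} (h : P.IsOptimal Xs ys) {t : ℕ} (ht : 1 ≤ t) {s : ℝ}
    (hs : s ∈ Set.Icc (0 : ℝ) 1) :
    P.f (X (t + 1)) (y (t + 1)) - P.f Xs ys ≤ (1 - s) * (P.f (X t) (y t) - P.f Xs ys)
      + s ^ 2 * (4 * (β * (‖P.A‖ ^ 2 + Metric.diam P.K ^ 2))) := by
  have h1 := hR.step_le_of_isOptimal hP h ht hs
  have h2 : inner ℝ (P.gradX (X t) (y t)) (outer (v t) - Xs) ≤ 0 := by
    rw [inner_sub_right]
    exact sub_nonpos.2 (hR.inner_outer_le ht h.1)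
  have h3 := mul_nonpos_of_nonneg_of_nonpos hs.1 h2
  have h4 : ‖outer (v t) - X t‖ ≤ 2 := by
    refine (norm_sub_le _ _).trans ?_
    linarith [norm_le_one_of_mem_spectrahedron (hR.outer_mem ht),
      norm_le_one_of_mem_spectrahedron (hR.mem ht).1]
  have h5 : ‖P.A (outer (v t) - X t)‖ ^ 2 ≤ (‖P.A‖ * 2) ^ 2 :=
    pow_le_pow_left₀ (norm_nonneg _) ((P.A.le_opNorm _).trans
      (mul_le_mul_of_nonneg_left h4 (norm_nonneg P.A))) 2
  have h6 : ‖ys - y t‖ ^ 2 ≤ Metric.diam P.K ^ 2 := by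
    rw [← dist_eq_norm]
    exact pow_le_pow_left₀ dist_nonneg
      (Metric.dist_le_diam_of_mem hP.compact.isBounded h.2.1 (hR.mem ht).2) 2
  have hβ := hP.β_pos
  have h7 : ‖P.A (outer (v t) - X t)‖ ^ 2 + ‖ys - y t‖ ^ 2 ≤
      4 * (‖P.A‖ ^ 2 + Metric.diam P.K ^ 2) := by nlinarith [sq_nonneg (Metric.diam P.K)]
  have h8 := mul_le_mul_of_nonneg_left h7 (show 0 ≤ β * s ^ 2 by positivity)
  linarith

end IsRun

end Problem

/-- The `O(1/t)` bound for a sequence obeying the Frank-Wolfe recursion. -/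
theorem mul_le_of_recursion {h : ℕ → ℝ} {B : ℝ} (hB : 0 ≤ B)
    (hrec : ∀ t : ℕ, 1 ≤ t → ∀ s ∈ Set.Icc (0 : ℝ) 1, h (t + 1) ≤ (1 - s) * h t + s ^ 2 * B)
    {t : ℕ} (ht : 2 ≤ t) : h t * t ≤ 4 * B := by
  induction t, ht using Nat.le_induction with
  | base =>
    -- The full step `s = 1` erases the uncontrolled initial value, hence the start at `t = 2`.
    have := hrec 1 le_rfl 1 ⟨zero_le_one, le_rfl⟩
    norm_num at this ⊢
    linarith
  | succ t ht ih =>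
    have ht' : (2 : ℝ) ≤ t := by exact_mod_cast ht
    have h1 := hrec t (by omega) (2 / (t + 1)) ⟨by positivity, by
      rw [div_le_one (by positivity)]; linarith⟩
    have h2 : h (t + 1) * (t + 1) ≤ (t - 1) * h t + 4 * B / (t + 1) := by
      have e : ((1 - 2 / ((t : ℝ) + 1)) * h t + (2 / ((t : ℝ) + 1)) ^ 2 * B) * (t + 1) =
          (t - 1) * h t + 4 * B / (t + 1) := by
        field_simp
        ring
      rw [← e]
      exact mul_le_mul_of_nonneg_right h1 (by positivity)
    have h3 : (t - 1) * h t ≤ 4 * B - 4 * B / t := by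
      have e : 4 * B - 4 * B / (t : ℝ) = (t - 1) * (4 * B / t) := by field_simp
      rw [e]
      refine mul_le_mul_of_nonneg_left ?_ (by linarith)
      rwa [le_div_iff₀ (by linarith)]
    have h4 : 4 * B / ((t : ℝ) + 1) ≤ 4 * B / t :=
      div_le_div_of_nonneg_left (by positivity) (by linarith) (by linarith)
    push_cast
    linarith

/-! ### Eigenvector error and local linear contraction. -/

namespace Problem

variable {n p : ℕ} {P : Problem n p} {α β : ℝ} {X : ℕ → Sym n} {y : ℕ → Vec p} {v : ℕ → Vec n}
  {η : ℕ → ℝ}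

namespace IsRun

theorem norm_outer_sub_sq_le (hR : P.IsRun β X y v η) (hP : P.Regular α β) {Xs : Sym n}
    {ys : Vec p} (h : P.IsOptimal Xs ys) {hn : 2 ≤ n} {δ : ℝ} (hδ : P.GapAssumption hn δ) {t : ℕ}
    (ht : 1 ≤ t) :
    ‖outer (v t) - Xs‖ ^ 2 ≤
      8 * (β ^ 2 * ‖P.A‖ ^ 2 / (α * δ ^ 2) * (P.f (X t) (y t) - P.f Xs ys)) := by
  have hα := hP.α_pos
  have hδ0 := hδ.1
  have h1 := norm_sub_le_of_sharp (h.sharp hP hδ (hR.outer_mem ht)) (hR.inner_outer_le ht h.1)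
  have h2 := h.norm_gradX_sub_sq_le hP hδ (hR.mem ht).1 (hR.mem ht).2
  have h3 := mul_le_mul_of_nonneg_left
    (pow_le_pow_left₀ (by positivity) h1 2) hα.le
  have e : 8 * (β ^ 2 * ‖P.A‖ ^ 2 / (α * δ ^ 2) * (P.f (X t) (y t) - P.f Xs ys)) =
      8 * (β ^ 2 * ‖P.A‖ ^ 2 * (P.f (X t) (y t) - P.f Xs ys)) / (α * δ ^ 2) := by ring
  rw [e, le_div_iff₀ (by positivity)]
  linarith

/-- The linear contraction near the optimum. -/
theorem contraction_of_near (hR : P.IsRun β X y v η) (hP : P.Regular α β) {Xs : Sym n}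
    {ys : Vec p} (h : P.IsOptimal Xs ys) {hn : 2 ≤ n} {δ : ℝ} (hδ : P.GapAssumption hn δ) {t : ℕ}
    (ht : 1 ≤ t)
    (hnear : 128 * (‖P.A‖ ^ 2 * β ^ 2 * (P.f (X t) (y t) - P.f Xs ys)) ≤ α * δ ^ 2) :
    P.f (X (t + 1)) (y (t + 1)) - P.f Xs ys ≤
      (P.f (X t) (y t) - P.f Xs ys) * (1 - rate α β δ ‖P.A‖) := by
  have hα := hP.α_pos
  have hβ := hP.β_pos
  have hδ0 := hδ.1
  set ρ := rate α β δ ‖P.A‖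
  have hρ0 : 0 < ρ := rate_pos hα hβ hδ0 (norm_nonneg P.A)
  have hρ6 : ρ ≤ 1 / 6 := rate_le_sixth ..
  have hρa : ρ * (72 * β * ‖P.A‖ ^ 2) ≤ δ := rate_mul_le_gap hβ hδ0
  have hρ1 : ρ * (4 * β * (6 * ‖P.A‖ ^ 2 / δ + 2 / α)) ≤ 1 :=
    rate_mul_le_one hα hβ hδ0 (norm_nonneg P.A)
  set H := P.f (X t) (y t) - P.f Xs ys with hH
  have hH0 : 0 ≤ H := sub_nonneg.2 (h.2.2 _ (hR.mem ht).1 _ (hR.mem ht).2)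
  have hε : 8 * ‖P.gradX (X t) (y t) - P.gradX Xs ys‖ ≤ δ := by
    have h1 := h.norm_gradX_sub_sq_le hP hδ (hR.mem ht).1 (hR.mem ht).2
    refine (pow_le_pow_iff_left₀ (by positivity) hδ0.le two_ne_zero).1 ?_
    refine le_of_mul_le_mul_left ?_ hα
    linarith
  have hV : inner ℝ (P.gradX (X t) (y t)) (outer (v t) - Xs) ≤
      -(δ / 4) * ‖outer (v t) - Xs‖ ^ 2 := by
    obtain ⟨x, l, hx, rfl, hl, hG⟩ := h.exists_outer hP hδ
    obtain ⟨μ, hμ, hmin⟩ := (hR.v_step t ht).exists_of_neg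
    exact inner_outer_sub_le_of_near hδ0 (hR.v_step t ht).1 hx hl hG hμ (hmin _ h.1) hε
  -- With `s = 2ρ` the gap decreases by `2ρH`; `hρ1` limits the quadratic error to `ρH`, and `hρa`
  -- lets the negative `N`-term from `hV` absorb the positive one.
  have hstep := hR.step_le_of_isOptimal hP h ht (s := 2 * ρ) ⟨by linarith, by linarith⟩
  have hy := h.norm_y_sub_sq_le hP hδ (hR.mem ht).1 (hR.mem ht).2
  rw [norm_sub_rev] at hy
  have hX : ‖X t - Xs‖ ^ 2 ≤ 2 / δ * H := by
    have h1 := h.growth hP hδ (hR.mem ht).1 (hR.mem ht).2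
    have h2 : 0 ≤ α / 2 * ‖P.A (X t - Xs) + (y t - ys)‖ ^ 2 := by positivity
    rw [div_mul_eq_mul_div, le_div_iff₀ hδ0]
    linarith
  have hA : ‖P.A (outer (v t) - X t)‖ ^ 2 ≤
      ‖P.A‖ ^ 2 * (2 * (‖outer (v t) - Xs‖ ^ 2 + ‖X t - Xs‖ ^ 2)) := by
    have h1 : ‖outer (v t) - X t‖ ≤ ‖outer (v t) - Xs‖ + ‖X t - Xs‖ := by
      rw [← sub_sub_sub_cancel_right _ _ Xs]; exact norm_sub_le _ _
    calc _ ≤ (‖P.A‖ * ‖outer (v t) - X t‖) ^ 2 :=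
          pow_le_pow_left₀ (norm_nonneg _) (P.A.le_opNorm _) 2
      _ = ‖P.A‖ ^ 2 * ‖outer (v t) - X t‖ ^ 2 := mul_pow _ _ _
      _ ≤ _ := mul_le_mul_of_nonneg_left
          ((pow_le_pow_left₀ (norm_nonneg _) h1 2).trans add_sq_le) (by positivity)
  set N := ‖outer (v t) - Xs‖ ^ 2 with hN
  have hN0 : 0 ≤ N := sq_nonneg _
  have h1 : ‖P.A (outer (v t) - X t)‖ ^ 2 + ‖ys - y t‖ ^ 2 ≤
      2 * ‖P.A‖ ^ 2 * N + (6 * ‖P.A‖ ^ 2 / δ + 2 / α) * H := by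
    have h2 := mul_le_mul_of_nonneg_left hX (show 0 ≤ 2 * ‖P.A‖ ^ 2 by positivity)
    have e : (6 * ‖P.A‖ ^ 2 / δ + 2 / α) * H =
        2 * ‖P.A‖ ^ 2 * (2 / δ * H) + 2 * (‖P.A‖ ^ 2 / δ + 1 / α) * H := by ring
    linarith
  have h2 := mul_le_mul_of_nonneg_left h1 (show 0 ≤ β * (2 * ρ) ^ 2 by positivity)
  have h3 := mul_le_mul_of_nonneg_left hV (show 0 ≤ 2 * ρ by positivity)
  have h4 := mul_le_mul_of_nonneg_right hρa (show 0 ≤ ρ * N by positivity)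
  have h5 := mul_le_mul_of_nonneg_right hρ1 (show 0 ≤ ρ * H by positivity)
  have h6 : 0 ≤ ρ * (β * ‖P.A‖ ^ 2) * (ρ * N) := by positivity
  have h7 : 0 ≤ δ * (ρ * N) := by positivity
  linarith

end IsRun

end Problem

end FWMix

/-! ### Assembly and the burn-in time. -/

theorem mainTheorem5 :
    ∃ M : ℝ, 0 < M ∧
      ∀ (n p : ℕ) (P : FWMix.Problem n p) (α β : ℝ),
        0 < α → 0 < β →
        StrongConvexOn Set.univ α P.g → FWMix.IsSmooth β P.g →
        Convex ℝ P.K → IsCompact P.K →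
        ∀ (X : ℕ → FWMix.Sym n) (y : ℕ → FWMix.Vec p) (v : ℕ → FWMix.Vec n) (η : ℕ → ℝ),
          P.IsRun β X y v η →
          ∀ h : ℕ → ℝ, (∀ t, h t = P.f (X t) (y t) - P.fstar) →
          (∀ t : ℕ, 2 ≤ t →
            h t ≤ M * (β * (‖P.A‖ ^ 2 + Metric.diam P.K ^ 2) / t)) ∧
          ∀ (hn : 2 ≤ n) (δ : ℝ), P.GapAssumption hn δ →
            (∃ T₀ : ℕ,
              (T₀ : ℝ) ≤ M * (‖P.A‖ ^ 2 * β ^ 3 * (‖P.A‖ ^ 2 + Metric.diam P.K ^ 2)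
                / (α * δ ^ 2)) ∧
              ∀ t : ℕ, 1 ≤ t → T₀ ≤ t →
                h (t + 1) ≤ h t * (1 - FWMix.rate α β δ ‖P.A‖)) ∧
            ∃ (Xs : FWMix.Sym n) (ys : FWMix.Vec p),
              (∀ (X' : FWMix.Sym n) (y' : FWMix.Vec p),
                P.IsOptimal X' y' ↔ X' = Xs ∧ y' = ys) ∧
              ∀ t : ℕ, 1 ≤ t →
                ‖FWMix.outer (v t) - Xs‖ ^ 2 ≤
                  M * (β ^ 2 * ‖P.A‖ ^ 2 / (α * δ ^ 2) * h t) := by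
  -- `4096 = 32 * 128`: here `128` is the nearness threshold and `32` comes from `h t * t ≤ 16 * S`
  -- together with `Q ≤ 2 * t`.
  refine ⟨4096, by norm_num, ?_⟩
  intro n p P α β hα hβ hs hg hK hKc X y v η hR h hh
  have hP : P.Regular α β := ⟨hα, hβ, hs, hg, hK, hKc⟩
  obtain ⟨Xs, ys, hopt⟩ := hP.exists_isOptimal hR.X_init hR.y_init
  simp only [hopt.fstar_eq] at hh
  set S := β * (‖P.A‖ ^ 2 + Metric.diam P.K ^ 2) with hS
  have hS0 : 0 ≤ S := by positivity
  have hrec : ∀ t : ℕ, 1 ≤ t → ∀ s ∈ Set.Icc (0 : ℝ) 1,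
      h (t + 1) ≤ (1 - s) * h t + s ^ 2 * (4 * S) := by
    intro t ht s hs
    simp only [hh]
    exact hR.step_le_diam hP hopt ht hs
  have hh0 : ∀ t, 1 ≤ t → 0 ≤ h t := by
    intro t ht
    rw [hh]
    exact sub_nonneg.2 (hopt.2.2 _ (hR.mem ht).1 _ (hR.mem ht).2)
  have hsub : ∀ t : ℕ, 2 ≤ t → h t * t ≤ 16 * S := by
    intro t ht
    linarith [FWMix.mul_le_of_recursion (show 0 ≤ 4 * S by positivity) hrec ht]
  refine ⟨fun t ht => ?_, fun hn δ hδ => ⟨?_, Xs, ys, fun X' y' => ⟨hopt.eq_of_gap hP hδ, ?_⟩, ?_⟩⟩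
  · have ht0 : (0 : ℝ) < t := by exact_mod_cast (by omega : 0 < t)
    rw [← mul_div_assoc, le_div_iff₀ ht0]
    linarith [hsub t ht]
  · have hδ0 := hδ.1
    set Q := 4096 * (‖P.A‖ ^ 2 * β ^ 3 * (‖P.A‖ ^ 2 + Metric.diam P.K ^ 2) / (α * δ ^ 2)) with hQ
    have hQ0 : 0 ≤ Q := by positivity
    refine ⟨⌊Q⌋₊, Nat.floor_le hQ0, fun t ht hT => ?_⟩
    have hρ := FWMix.rate_le_sixth α β δ ‖P.A‖
    -- The sublinear bound can fail only at `t = 1`; then the full step gives `h 2 ≤ 4 * S < h 1 /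
    -- 4`, better than the factor `5 / 6`.
    by_cases hbig : 16 * S < h t * t
    · obtain rfl : t = 1 := by
        by_contra hne
        exact absurd (hsub t (by omega)) (not_le.2 hbig)
      have h1 := hrec 1 le_rfl 1 ⟨zero_le_one, le_rfl⟩
      norm_num at h1 hbig
      nlinarith [hh0 1 le_rfl]
    -- The floor keeps `T₀ ≤ Q` exactly; the unit lost by rounding is absorbed by `t ≥ 1`.
    · have hQt : Q ≤ 2 * t := by
        have h1 := Nat.lt_floor_add_one Q
        have h2 : (⌊Q⌋₊ : ℝ) ≤ t := by exact_mod_cast hT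
        have h3 : (1 : ℝ) ≤ t := by exact_mod_cast ht
        linarith
      have hht := hh0 t ht
      rw [hh, hh]
      refine hR.contraction_of_near hP hopt hδ ht ?_
      rw [← hh]
      have h1 : h t * Q ≤ 32 * S := by
        linarith [mul_le_mul_of_nonneg_left hQt hht]
      have e : h t * Q = h t * (4096 * (‖P.A‖ ^ 2 * β ^ 2 * S)) / (α * δ ^ 2) := by
        rw [hQ, hS]; ring
      rw [e, div_le_iff₀ (by positivity)] at h1
      -- Cancelling `S` needs `S > 0`; if `S = 0` then `𝒜 = 0` and nearness is automatic.
      rcases hS0.eq_or_lt with h0 | h0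
      · have h2 : ‖P.A‖ ^ 2 = 0 := by
          rcases mul_eq_zero.1 h0.symm with h3 | h3
          · exact absurd h3 hβ.ne'
          · linarith [sq_nonneg ‖P.A‖, sq_nonneg (Metric.diam P.K)]
        rw [h2, zero_mul, zero_mul, mul_zero]
        positivity
      · refine le_of_mul_le_mul_left ?_ h0
        linarith
  · rintro ⟨rfl, rfl⟩
    exact hopt
  · intro t ht
    have h1 := hR.norm_outer_sub_sq_le hP hopt hδ ht
    rw [← hh] at h1
    have h2 : 0 ≤ β ^ 2 * ‖P.A‖ ^ 2 / (α * δ ^ 2) * h t :=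
      mul_nonneg (by positivity) (hh0 t ht)
    linarith
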